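/- Let $\Omega\subset\mathbb R^2$ be open and $T>0$. Let $\sigma:\Omega\to\mathbb R$ be measurable with $0\le\sigma\le\sigma^*$ a.e. in $\Omega$ for a constant $\sigma^*$, let $\boldsymbol u:[0,T]\times\Omega\to\mathbb R^2$ be measurable and bounded, let $E_0\in L^2(0,T;H(\mathrm{rot};\Omega))$ with $E_0(t)\in H(\mathrm{rot};\Omega)$ for every $t\in[0,T]$, and let $\boldsymbol B_0\in L^2(\Omega)^2$. Here $\mathbf{rot}\,v=(\partial_yv,-\partial_xv)$ for scalar $v$ (in the weak sense), $H(\mathrm{rot};\Omega)=\{v\in L^2(\Omega):\mathbf{rot}\,v\in L^2(\Omega)^2\}$, $H_0(\mathrm{rot};\Omega)$ is the closure of $C_c^\infty(\Omega)$ in it, $H(\mathrm{div};\Omega)$ is the space of fields in $L^2(\Omega)^2$ with weak divergence in $L^2(\Omega)$, $\boldsymbol u\times\boldsymbol B=u_1B_2-u_2B_1$, $(\cdot,\cdot)$ and $\|\cdot\|_{0,\Omega}$ are the $L^2(\Omega)$ inner product and norm, and $\|\boldsymbol u(t)\|_\infty$ is the norm of $\boldsymbol u(\cdot,t)$ in $L^\infty(\Omega)^2$.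 We say that $(\boldsymbol B,\widehat E)$ satisfies the variational equations at the time $t\in[0,T]$ if $\boldsymbol B(t)\in H(\mathrm{div};\Omega)$, $\widehat E(t)\in H_0(\mathrm{rot};\Omega)$, the derivative $\partial_t\boldsymbol B(t)$ exists in $L^2(\Omega)^2$ (one-sided at the ends of $[0,T]$), and $$(\partial_t\boldsymbol B,\boldsymbol w)+(\mathbf{rot}\,\widehat E,\boldsymbol w)=-(\mathbf{rot}\,E_0,\boldsymbol w)\quad\text{for all }\boldsymbol w\in H(\mathrm{div};\Omega),$$ $$(\sigma\widehat E,v)+(\sigma\,\boldsymbol u\times\boldsymbol B,v)-(\boldsymbol B,\mathbf{rot}\,v)=-(\sigma E_0,v)\quad\text{for all }v\in H_0(\mathrm{rot};\Omega)$$ hold at $t$. A solution is a pair $(\boldsymbol B,\widehat E)$ with $\boldsymbol B:[0,T]\to L^2(\Omega)^2$ absolutely continuous, $\boldsymbol B(0)=\boldsymbol B_0$, $\widehat E$ (strongly) measurable in time together with $\mathbf{rot}\,\widehat E$ as $L^2$-valued functions, that satisfies these equations at almost every $t\in[0,T]$. (For solutions with $\boldsymbol B\in C^1([0,T];L^2(\Omega)^2)$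 and $\widehat E\in C([0,T];H_0(\mathrm{rot};\Omega))$ whose equations hold on all of $[0,T]$, the estimate (1) below therefore holds at every $t$.) Theorem. Let $(\boldsymbol B,\widehat E)$ be a solution, and put $\|E\|_{\mathrm{curl},\sigma}^2=\|\sigma^{1/2}E\|_{0,\Omega}^2+\|\mathbf{rot}\,E\|_{0,\Omega}^2$. At every $t\in[0,T]$ at which the variational equations hold, $\|\boldsymbol B\|_{0,\Omega}^2$ is differentiable (within $[0,T]$) and $$\frac{d}{dt}\|\boldsymbol B\|_{0,\Omega}^2+\tfrac12\|\sigma^{1/2}\widehat E\|_{0,\Omega}^2\le\|E_0\|_{\mathrm{curl},\sigma}^2+\bigl(2\sigma^*\|\boldsymbol u\|_\infty^2+1\bigr)\|\boldsymbol B\|_{0,\Omega}^2.\tag{1}$$ Consequently, the function $\beta:[0,T]\to(0,1]$, $\beta(t)=\exp\bigl(-\int_0^t(2\sigma^*\|\boldsymbol u(\tau)\|_\infty^2+1)\,d\tau\bigr)$, is well defined (its integrand is integrable on $[0,T]$), the functions $\beta\|\sigma^{1/2}\widehat E\|_{0,\Omega}^2$ and $\beta\|E_0\|_{\mathrm{curl},\sigma}^2$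 are integrable on $[0,T]$, and for every $t\in[0,T]$ $$\beta(t)\|\boldsymbol B(t)\|_{0,\Omega}^2+\tfrac12\int_0^t\beta(\tau)\|\sigma^{1/2}\widehat E(\tau)\|_{0,\Omega}^2\,d\tau\le\int_0^t\beta(\tau)\|E_0(\tau)\|_{\mathrm{curl},\sigma}^2\,d\tau+\|\boldsymbol B_0\|_{0,\Omega}^2.\tag{2}$$ (If $\sigma^*\ge1$, then $(\sigma^*)^2$ is also an upper bound of $\sigma$, and (1) and (2) hold with $(\sigma^*)^2$ in place of $\sigma^*$.) -/

import Mathlib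

open MeasureTheory Set
open scoped ENNReal ContDiff

noncomputable section

namespace ResistiveMHD

/-- The Euclidean plane. -/
abbrev Plane : Type := EuclideanSpace ℝ (Fin 2)

/-- Scalar fields in `L²(Ω)`. -/
abbrev L2S (Ω : Set Plane) : Type := Lp ℝ 2 (volume.restrict Ω)

/-- Vector fields in `L²(Ω)²`. -/
abbrev L2V (Ω : Set Plane) : Type := Lp Plane 2 (volume.restrict Ω)

/-- Test functions, the elements of `C_c^∞(Ω)`. -/
def IsTest (Ω : Set Plane) (φ : Plane → ℝ) : Prop :=
  ContDiff ℝ ∞ φ ∧ HasCompactSupport φ ∧ tsupport φ ⊆ Ω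

/-- The classical partial derivative `∂φ/∂xᵢ`. -/
def pd (i : Fin 2) (φ : Plane → ℝ) (x : Plane) : ℝ :=
  fderiv ℝ φ x (EuclideanSpace.single i 1)

/-- The vector rotational `rot φ = (∂φ/∂y, -∂φ/∂x)` of a smooth scalar field. -/
def rotSmooth (φ : Plane → ℝ) (x : Plane) : Plane :=
  !₂[pd 1 φ x, -pd 0 φ x]

/-- The space `H(div; Ω)`: the fields in `L²(Ω)²` with a weak divergence in `L²(Ω)`. -/
def HDiv (Ω : Set Plane) : Set (L2V Ω) :=
  {w | ∃ g : L2S Ω, ∀ φ : Plane → ℝ, IsTest Ω φ →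
    ∫ x in Ω, (w x 0 * pd 0 φ x + w x 1 * pd 1 φ x) = -∫ x in Ω, g x * φ x}

/-- The space `H(rot; Ω)`, every element `v` being given together with its weak rotational, that is
as the pair `(v, rot v)`. The weak rotational `r` of `v` is defined by
`∫ r · ψ = ∫ v (∂ψ₁/∂x - ∂ψ₀/∂y)` for every smooth compactly supported vector field `ψ`. -/
def HRot (Ω : Set Plane) : Set (L2S Ω × L2V Ω) :=
  {p | ∀ ψ₀ ψ₁ : Plane → ℝ, IsTest Ω ψ₀ → IsTest Ω ψ₁ →
    ∫ x in Ω, (p.2 x 0 * ψ₀ x + p.2 x 1 * ψ₁ x) =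
      ∫ x in Ω, p.1 x * (pd 0 ψ₁ x - pd 1 ψ₀ x)}

/-- The space `H₀(rot; Ω)`, the closure of `C_c^∞(Ω)` in `H(rot; Ω)`, again as a set of pairs
`(v, rot v)`. -/
def HRotZero (Ω : Set Plane) : Set (L2S Ω × L2V Ω) :=
  closure {p | ∃ φ : Plane → ℝ, IsTest Ω φ ∧
    p.1 =ᵐ[volume.restrict Ω] φ ∧ p.2 =ᵐ[volume.restrict Ω] rotSmooth φ}

/-- The scalar cross product `a × b` of two plane vectors. -/
def cross (a b : Plane) : ℝ := a 0 * b 1 - a 1 * b 0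

/-- The norm of `L^∞(Ω)²`. -/
def supNorm (Ω : Set Plane) (u : Plane → Plane) : ℝ :=
  (eLpNorm u ∞ (volume.restrict Ω)).toReal

/-- `‖σ^{1/2} v‖²` in `L²(Ω)`. -/
def sigmaNormSq (Ω : Set Plane) (σ : Plane → ℝ) (v : L2S Ω) : ℝ :=
  ∫ x in Ω, (√(σ x) * v x) ^ 2

/-- `‖E‖²_{curl,σ} = ‖σ^{1/2} E‖² + ‖rot E‖²` for `E` given as the pair `(E, rot E)`. -/
def curlSigmaNormSq (Ω : Set Plane) (σ : Plane → ℝ) (p : L2S Ω × L2V Ω) : ℝ :=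
  sigmaNormSq Ω σ p.1 + ‖p.2‖ ^ 2

/-- The variational equations at the time `t ∈ [0, T]`: with `b = ∂B/∂t` (one-sided at the ends of
`[0, T]`),
`(b, w) + (rot Ê, w) = -(rot E₀, w)` for all `w ∈ H(div; Ω)`,
`(σ Ê, v) + (σ u × B, v) - (B, rot v) = -(σ E₀, v)` for all `v ∈ H₀(rot; Ω)`,
where `B(t) ∈ H(div; Ω)` and `Ê(t) ∈ H₀(rot; Ω)`. -/
def SolvesAt (Ω : Set Plane) (T : ℝ) (σ : Plane → ℝ) (u : ℝ → Plane → Plane)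
    (E₀ : ℝ → L2S Ω × L2V Ω) (B : ℝ → L2V Ω) (Ehat : ℝ → L2S Ω × L2V Ω) (t : ℝ) : Prop :=
  B t ∈ HDiv Ω ∧ Ehat t ∈ HRotZero Ω ∧
  ∃ b : L2V Ω, HasDerivWithinAt B b (Icc 0 T) t ∧
    (∀ w ∈ HDiv Ω,
      inner ℝ b w + inner ℝ (Ehat t).2 w = -inner ℝ (E₀ t).2 w) ∧
    (∀ v ∈ HRotZero Ω,
      (∫ x in Ω, σ x * (Ehat t).1 x * v.1 x)
        + (∫ x in Ω, σ x * cross (u t x) (B t x) * v.1 x)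
        - inner ℝ (B t) v.2
      = -∫ x in Ω, σ x * (E₀ t).1 x * v.1 x)

/-- Solutions `(B, Ê)` of the continuous variational formulation on `[0, T]` with initial value
`B₀`. Asked in time are only absolute continuity of `B` with values in `L²(Ω)²`, measurability of
`Ê` and validity of the equations at almost every time, so that solutions of class
`C¹([0, T]) × C⁰([0, T])`, for which the equations hold at every time, are included. -/
structure IsSolution (Ω : Set Plane) (T : ℝ) (σ : Plane → ℝ) (u : ℝ → Plane → Plane)
    (E₀ : ℝ → L2S Ω × L2V Ω) (B₀ : L2V Ω) (B : ℝ → L2V Ω)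
    (Ehat : ℝ → L2S Ω × L2V Ω) : Prop where
  absCont : AbsolutelyContinuousOnInterval B 0 T
  initial : B 0 = B₀
  measurable : AEStronglyMeasurable Ehat (volume.restrict (Icc 0 T))
  equations : ∀ᵐ t ∂(volume.restrict (Icc 0 T)), SolvesAt Ω T σ u E₀ B Ehat t

end ResistiveMHD

end

/-! ### Absolute continuity and the integrating factor. -/

open scoped NNReal

/-! At a time at which the equations hold, `B` and `Ê` are admissible test functions. Testing with
them makes `(rot Ê, B)` cancel, so that `d/dt ‖B‖²` equals `-2‖σ^{1/2}Ê‖² - 2(σ u × B, Ê) - 2(σE₀,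
Ê) - 2(rot E₀, B)`. Young's inequality absorbs the mixed terms at the cost of three quarters of the
dissipation; what is left is (1), proved in `SolvesAt.energy_estimate`.

For (2), multiply (1) by `β`: since `β' = -βg` almost everywhere, the term `g‖B‖²` disappears into
`(β‖B‖²)'`. As `β‖B‖²` is absolutely continuous, the fundamental theorem of calculus applies
although (1) holds only almost everywhere (`integratingFactor_estimate`). -/

/-- Lipschitz functions preserve absolute continuity. -/
theorem LipschitzOnWith.comp_absolutelyContinuousOnInterval {X Y : Type*}
    [PseudoMetricSpace X] [PseudoMetricSpace Y] {g : X → Y} {K : ℝ≥0} {s : Set X}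
    (hg : LipschitzOnWith K g s) {f : ℝ → X} {a b : ℝ}
    (hf : AbsolutelyContinuousOnInterval f a b) (hfs : MapsTo f (uIcc a b) s) :
    AbsolutelyContinuousOnInterval (fun t => g (f t)) a b := by
  rw [absolutelyContinuousOnInterval_iff] at hf ⊢
  intro ε hε
  -- Dividing by `K + 1` instead of `K` covers `K = 0`.
  obtain ⟨δ, hδ, h⟩ := hf (ε / (K + 1)) (by positivity)
  refine ⟨δ, hδ, fun E hE hlt => ?_⟩
  have h1 := h E hE hlt
  rw [lt_div_iff₀ (by positivity)] at h1
  refine lt_of_le_of_lt ?_ h1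
  rw [Finset.sum_mul]
  refine Finset.sum_le_sum fun i hi => ?_
  have hmem := hE.1 i hi
  have h2 := hg.dist_le_mul _ (hfs hmem.1) _ (hfs hmem.2)
  have h3 : (0 : ℝ) ≤ dist (f (E.2 i).1) (f (E.2 i).2) := dist_nonneg
  nlinarith

theorem AbsolutelyContinuousOnInterval.norm {E : Type*} [SeminormedAddCommGroup E] {f : ℝ → E}
    {a b : ℝ} (hf : AbsolutelyContinuousOnInterval f a b) :
    AbsolutelyContinuousOnInterval (fun t => ‖f t‖) a b :=
  lipschitzWith_one_norm.lipschitzOnWith.comp_absolutelyContinuousOnInterval hf (mapsTo_univ _ _)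

/-- Makes `β` absolutely continuous: its exponent is absolutely continuous and, as `g ≥ 0`,
nonpositive. -/
theorem Real.lipschitzOnWith_exp_Iic_zero : LipschitzOnWith 1 Real.exp (Iic 0) := by
  refine (convex_Iic (0 : ℝ)).lipschitzOnWith_of_nnnorm_deriv_le
    (fun x _ => Real.differentiableAt_exp) fun x hx => ?_
  rw [Real.deriv_exp, ← NNReal.coe_le_coe, coe_nnnorm, Real.norm_eq_abs, Real.abs_exp]
  exact Real.exp_le_one_iff.2 hx

/-- The Gronwall argument with an integrating factor, for a differential inequality that holds
almost everywhere. -/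
theorem integratingFactor_estimate {T : ℝ} (hT : 0 < T) {y g S F : ℝ → ℝ}
    (hy : AbsolutelyContinuousOnInterval y 0 T)
    (hg : IntervalIntegrable g volume 0 T) (hg0 : ∀ t ∈ Icc 0 T, 0 ≤ g t)
    (hF : IntervalIntegrable F volume 0 T)
    (hS : AEStronglyMeasurable S (volume.restrict (Icc 0 T))) (hS0 : ∀ t, 0 ≤ S t)
    (h : ∀ᵐ t ∂(volume.restrict (Icc 0 T)), ∃ d, HasDerivWithinAt y d (Icc 0 T) t ∧
      d + 1 / 2 * S t ≤ F t + g t * y t)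
    {β : ℝ → ℝ} (hβ : ∀ t, β t = Real.exp (-∫ τ in (0 : ℝ)..t, g τ)) :
    (∀ t ∈ Icc 0 T, 0 < β t ∧ β t ≤ 1) ∧
      IntervalIntegrable (fun τ => β τ * S τ) volume 0 T ∧
      IntervalIntegrable (fun τ => β τ * F τ) volume 0 T ∧
      ∀ t ∈ Icc 0 T, β t * y t + 1 / 2 * ∫ τ in (0 : ℝ)..t, β τ * S τ ≤
        (∫ τ in (0 : ℝ)..t, β τ * F τ) + y 0 := by
  have hT' := hT.le
  have hI0 : ∀ t ∈ Icc 0 T, 0 ≤ ∫ τ in (0 : ℝ)..t, g τ := fun t ht =>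
    intervalIntegral.integral_nonneg ht.1 fun τ hτ => hg0 τ ⟨hτ.1, hτ.2.trans ht.2⟩
  have hβeq : β = fun t => Real.exp (-∫ τ in (0 : ℝ)..t, g τ) := funext hβ
  have hβAC : AbsolutelyContinuousOnInterval β 0 T := by
    rw [hβeq]
    refine Real.lipschitzOnWith_exp_Iic_zero.comp_absolutelyContinuousOnInterval
      (f := fun t => -∫ τ in (0 : ℝ)..t, g τ)
      (hg.absolutelyContinuousOnInterval_intervalIntegral left_mem_uIcc).neg ?_
    intro t ht
    rw [uIcc_of_le hT'] at ht
    exact neg_nonpos.2 (hI0 t ht)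
  have hβb : ∀ t ∈ Icc 0 T, 0 < β t ∧ β t ≤ 1 := fun t ht => by
    rw [hβ]
    exact ⟨Real.exp_pos _, Real.exp_le_one_iff.2 (neg_nonpos.2 (hI0 t ht))⟩
  have hβg : ∀ᵐ t, t ∈ Icc 0 T → HasDerivAt β (-(β t * g t)) t := by
    filter_upwards [hg.ae_hasDerivAt_integral] with t ht hmem
    rw [← uIcc_of_le hT'] at hmem
    have := (ht hmem 0 left_mem_uIcc).neg.exp
    rw [hβeq]
    convert! this using 1
    exact (mul_neg _ _).symm
  have hyd : ∀ᵐ t, t ∈ Icc 0 T →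
      HasDerivAt y (deriv y t) t ∧ deriv y t + 1 / 2 * S t ≤ F t + g t * y t := by
    -- Away from the two endpoints the derivative within `Icc 0 T` is a genuine one.
    have h0 : ∀ᵐ t : ℝ, t ≠ 0 := by simp [ae_iff, measure_singleton]
    have h1 : ∀ᵐ t : ℝ, t ≠ T := by simp [ae_iff, measure_singleton]
    filter_upwards [(ae_restrict_iff' measurableSet_Icc).1 h, h0, h1] with t ht h0 h1 hmem
    obtain ⟨d, hd, hle⟩ := ht hmem
    have hd' := hd.hasDerivAt
      (Icc_mem_nhds (lt_of_le_of_ne hmem.1 h0.symm) (lt_of_le_of_ne hmem.2 h1))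
    rw [hd'.deriv]
    exact ⟨hd', hle⟩
  -- Integrability of `S` is a consequence of the inequality: `0 ≤ S ≤ 2(F + gy - y')`, and `y'` is
  -- integrable because `y` is absolutely continuous.
  have hSI : IntervalIntegrable S volume 0 T := by
    have hdom : IntervalIntegrable (fun t => 2 * (F t + g t * y t - deriv y t)) volume 0 T :=
      ((hF.add (hg.mul_continuousOn hy.continuousOn)).sub hy.intervalIntegrable_deriv).const_mul 2
    refine hdom.mono_fun' ?_ ?_
    · rw [uIoc_of_le hT']
      exact hS.mono_measure (Measure.restrict_mono Ioc_subset_Icc_self le_rfl)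
    · rw [uIoc_of_le hT', Filter.EventuallyLE, ae_restrict_iff' measurableSet_Ioc]
      filter_upwards [hyd] with t ht hmem
      have := (ht (Ioc_subset_Icc_self hmem)).2
      rw [Real.norm_of_nonneg (hS0 t)]
      linarith
  have hβS : IntervalIntegrable (fun τ => β τ * S τ) volume 0 T :=
    hSI.continuousOn_mul hβAC.continuousOn
  have hβF : IntervalIntegrable (fun τ => β τ * F τ) volume 0 T :=
    hF.continuousOn_mul hβAC.continuousOn
  refine ⟨hβb, hβS, hβF, fun t ht => ?_⟩
  have hsub : uIcc 0 t ⊆ uIcc 0 T := by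
    rw [uIcc_of_le ht.1, uIcc_of_le hT']
    exact Icc_subset_Icc_right ht.2
  have hAC : AbsolutelyContinuousOnInterval (β * y) 0 t := (hβAC.mul hy).mono hsub
  have hS' := (hβS.mono_set hsub).const_mul (1 / 2)
  have hF' := hβF.mono_set hsub
  have hFTC := hAC.integral_deriv_eq_sub
  have hle : ∫ τ in (0 : ℝ)..t, deriv (β * y) τ ≤
      ∫ τ in (0 : ℝ)..t, (β τ * F τ - 1 / 2 * (β τ * S τ)) := by
    refine intervalIntegral.integral_mono_ae_restrict ht.1 hAC.intervalIntegrable_deriv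
      (hF'.sub hS') ?_
    rw [Filter.EventuallyLE, ae_restrict_iff' measurableSet_Icc]
    filter_upwards [hyd, hβg] with τ h1 h2 hmem
    have hτ : τ ∈ Icc 0 T := ⟨hmem.1, hmem.2.trans ht.2⟩
    obtain ⟨hy', hle⟩ := h1 hτ
    rw [((h2 hτ).mul hy').deriv]
    have := mul_le_mul_of_nonneg_left hle (hβb τ hτ).1.le
    linarith
  rw [hFTC, intervalIntegral.integral_sub hF' hS', intervalIntegral.integral_const_mul] at hle
  have hβ0 : β 0 = 1 := by simp [hβ]
  simp only [Pi.mul_apply, hβ0, one_mul] at hle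
  linarith

/-! ### Measurability in time of the `L^∞` norm. -/

noncomputable section

namespace ResistiveMHD

/-- The essential supremum is at most `c` exactly when the slice of `{c < ‖u‖}` at `t` is null, and
the measure of a slice is measurable in `t`. -/
theorem measurable_eLpNorm_top {α β : Type*} [MeasurableSpace α] [MeasurableSpace β]
    {E : Type*} [NormedAddCommGroup E] [MeasurableSpace E] [OpensMeasurableSpace E]
    {ν : Measure β} [SFinite ν] {u : α → β → E} (hu : Measurable (Function.uncurry u)) :
    Measurable fun t => eLpNorm (u t) ∞ ν := by
  refine measurable_of_Iic fun c => ?_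
  have hs : MeasurableSet {p : α × β | c < ‖u p.1 p.2‖ₑ} :=
    measurableSet_lt measurable_const hu.enorm
  have h : (fun t => eLpNorm (u t) ∞ ν) ⁻¹' Iic c =
      (fun t => ν (Prod.mk t ⁻¹' {p : α × β | c < ‖u p.1 p.2‖ₑ})) ⁻¹' {0} := by
    ext t
    simp only [mem_preimage, mem_Iic, mem_singleton_iff, eLpNorm_exponent_top]
    constructor
    · intro h
      have h1 : ∀ᵐ x ∂ν, ‖u t x‖ₑ ≤ c := by
        filter_upwards [ae_le_eLpNormEssSup (f := u t) (μ := ν)] with x hx using hx.trans h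
      rw [ae_iff] at h1
      simpa using h1
    · intro h
      refine eLpNormEssSup_le_of_ae_enorm_bound ?_
      rw [ae_iff]
      simpa using h
  rw [h]
  exact measurable_measure_prodMk_left hs (measurableSet_singleton 0)

/-! ### Bounds for the velocity and the weighted norms. -/

variable {Ω : Set Plane}

theorem abs_cross_le (a b : Plane) : |cross a b| ≤ ‖a‖ * ‖b‖ := by
  refine abs_le_of_sq_le_sq ?_ (by positivity)
  rw [mul_pow, EuclideanSpace.norm_sq_eq, EuclideanSpace.norm_sq_eq]
  simp only [Fin.sum_univ_two, Real.norm_eq_abs, sq_abs, cross]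
  -- Lagrange's identity: `(a × b)² + (a · b)² = ‖a‖²‖b‖²`.
  nlinarith [sq_nonneg (a 0 * b 0 + a 1 * b 1)]

theorem integral_norm_sq_eq (f : L2V Ω) : ∫ x in Ω, ‖f x‖ ^ 2 = ‖f‖ ^ 2 := by
  rw [← real_inner_self_eq_norm_sq, L2.inner_def]
  simp

theorem ae_norm_le_supNorm {v : Plane → Plane} {M : ℝ}
    (hv : ∀ᵐ x ∂(volume.restrict Ω), ‖v x‖ ≤ M) :
    ∀ᵐ x ∂(volume.restrict Ω), ‖v x‖ ≤ supNorm Ω v := by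
  -- Without finiteness `toReal` would return `0`.
  have hfin : eLpNorm v ∞ (volume.restrict Ω) ≠ ⊤ := by
    rw [eLpNorm_exponent_top]
    exact (eLpNormEssSup_lt_top_of_ae_bound hv).ne
  filter_upwards [ae_le_eLpNormEssSup (f := v) (μ := volume.restrict Ω)] with x hx
  rw [supNorm, eLpNorm_exponent_top] at *
  rw [← toReal_enorm]
  exact ENNReal.toReal_mono hfin hx

theorem supNorm_nonneg (v : Plane → Plane) : 0 ≤ supNorm Ω v := ENNReal.toReal_nonneg

theorem supNorm_le {v : Plane → Plane} {M : ℝ}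
    (hv : ∀ᵐ x ∂(volume.restrict Ω), ‖v x‖ ≤ M) : supNorm Ω v ≤ max M 0 := by
  refine ENNReal.toReal_le_of_le_ofReal (le_max_right _ _) ?_
  rw [eLpNorm_exponent_top]
  refine eLpNormEssSup_le_of_ae_bound ?_
  filter_upwards [hv] with x hx using hx.trans (le_max_left _ _)

/-- Nothing forces `σs ≥ 0` when `Ω` is a null set, but then `supNorm` vanishes. -/
theorem mul_supNorm_sq_nonneg {σ : Plane → ℝ} {σs : ℝ}
    (hσb : ∀ᵐ x ∂(volume.restrict Ω), 0 ≤ σ x ∧ σ x ≤ σs) (v : Plane → Plane) :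
    0 ≤ σs * supNorm Ω v ^ 2 := by
  rcases eq_or_ne (volume.restrict Ω) 0 with h0 | h0
  · simp [supNorm, h0]
  · have := ae_neBot.2 h0
    obtain ⟨x, hx⟩ := hσb.exists
    exact mul_nonneg (hx.1.trans hx.2) (sq_nonneg _)

theorem sigmaNormSq_nonneg (σ : Plane → ℝ) (v : L2S Ω) : 0 ≤ sigmaNormSq Ω σ v :=
  integral_nonneg fun _ => sq_nonneg _

/-- The weighted norm is the `L²` norm of the product with `σ^{1/2}`. -/
theorem exists_sigmaNormSq_eq {σ : Plane → ℝ} {σs : ℝ}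
    (hσ : AEMeasurable σ (volume.restrict Ω))
    (hσb : ∀ᵐ x ∂(volume.restrict Ω), 0 ≤ σ x ∧ σ x ≤ σs) :
    ∃ m : L2S Ω →L[ℝ] L2S Ω, ∀ v, sigmaNormSq Ω σ v = ‖m v‖ ^ 2 := by
  have hs : MemLp (fun x => √(σ x)) ∞ (volume.restrict Ω) := by
    refine memLp_top_of_bound hσ.sqrt.aestronglyMeasurable (√σs) ?_
    filter_upwards [hσb] with x hx
    rw [Real.norm_of_nonneg (Real.sqrt_nonneg _)]
    exact Real.sqrt_le_sqrt hx.2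
  refine ⟨(ContinuousLinearMap.mul ℝ ℝ).holderL (volume.restrict Ω) ∞ 2 2 hs.toLp, fun v => ?_⟩
  rw [← real_inner_self_eq_norm_sq, L2.inner_def, sigmaNormSq]
  refine integral_congr_ae ?_
  filter_upwards [(ContinuousLinearMap.mul ℝ ℝ).coeFn_holder (r := 2) hs.toLp v, hs.coeFn_toLp]
    with x hx hx'
  change _ = inner ℝ ((ContinuousLinearMap.mul ℝ ℝ).holder 2 hs.toLp v x)
    ((ContinuousLinearMap.mul ℝ ℝ).holder 2 hs.toLp v x)
  rw [hx, hx']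
  simp only [ContinuousLinearMap.mul_apply', real_inner_self_eq_norm_sq, Real.norm_eq_abs, sq_abs]

theorem integrable_weight_mul {σ : Plane → ℝ} {σs : ℝ}
    (hσ : AEMeasurable σ (volume.restrict Ω))
    (hσb : ∀ᵐ x ∂(volume.restrict Ω), 0 ≤ σ x ∧ σ x ≤ σs) {f g : Plane → ℝ}
    (hf : MemLp f 2 (volume.restrict Ω)) (hg : MemLp g 2 (volume.restrict Ω)) :
    Integrable (fun x => σ x * f x * g x) (volume.restrict Ω) := by
  simp only [mul_assoc]
  refine (hf.integrable_mul hg).bdd_mul (c := σs) hσ.aestronglyMeasurable ?_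
  filter_upwards [hσb] with x hx
  rw [Real.norm_of_nonneg hx.1]
  exact hx.2

theorem memLp_cross {v : Plane → Plane} (hv : AEStronglyMeasurable v (volume.restrict Ω)) {M : ℝ}
    (hM : ∀ᵐ x ∂(volume.restrict Ω), ‖v x‖ ≤ M) (f : L2V Ω) :
    MemLp (fun x => cross (v x) (f x)) 2 (volume.restrict Ω) := by
  have hf := Lp.memLp f
  have hc : Continuous fun p : Plane × Plane => cross p.1 p.2 := by
    unfold cross
    fun_prop
  refine hf.of_le_mul (c := M) (hc.comp_aestronglyMeasurable (hv.prodMk hf.1)) ?_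
  filter_upwards [hM] with x hx
  rw [Real.norm_eq_abs]
  exact (abs_cross_le _ _).trans (by gcongr)

theorem sigmaNormSq_eq_integral {σ : Plane → ℝ} {σs : ℝ}
    (hσb : ∀ᵐ x ∂(volume.restrict Ω), 0 ≤ σ x ∧ σ x ≤ σs) (v : L2S Ω) :
    sigmaNormSq Ω σ v = ∫ x in Ω, σ x * v x * v x := by
  refine integral_congr_ae ?_
  filter_upwards [hσb] with x hx
  simp only [mul_pow, Real.sq_sqrt hx.1]
  ring

theorem integral_weight_cross_sq_le {σ : Plane → ℝ} {σs : ℝ}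
    (hσ : AEMeasurable σ (volume.restrict Ω))
    (hσb : ∀ᵐ x ∂(volume.restrict Ω), 0 ≤ σ x ∧ σ x ≤ σs)
    {v : Plane → Plane} (hv : AEStronglyMeasurable v (volume.restrict Ω)) {M : ℝ}
    (hM : ∀ᵐ x ∂(volume.restrict Ω), ‖v x‖ ≤ M) (f : L2V Ω) :
    ∫ x in Ω, σ x * cross (v x) (f x) * cross (v x) (f x) ≤
      σs * supNorm Ω v ^ 2 * ‖f‖ ^ 2 := by
  rw [← integral_norm_sq_eq f, ← integral_const_mul]
  have hc := memLp_cross hv hM f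
  refine integral_mono_ae (integrable_weight_mul hσ hσb hc hc)
    ((Lp.memLp f).integrable_norm_pow two_ne_zero |>.const_mul _) ?_
  filter_upwards [hσb, ae_norm_le_supNorm hM] with x hx hvx
  have h1 : cross (v x) (f x) * cross (v x) (f x) ≤ supNorm Ω v ^ 2 * ‖f x‖ ^ 2 := by
    rw [← sq, ← sq_abs, ← mul_pow]
    exact pow_le_pow_left₀ (abs_nonneg _) ((abs_cross_le _ _).trans (by gcongr)) 2
  calc σ x * cross (v x) (f x) * cross (v x) (f x)
      = σ x * (cross (v x) (f x) * cross (v x) (f x)) := by ring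
    _ ≤ σs * (supNorm Ω v ^ 2 * ‖f x‖ ^ 2) :=
        mul_le_mul hx.2 h1 (mul_self_nonneg _) (hx.1.trans hx.2)
    _ = _ := by ring

/-! ### The differential energy estimate. -/

/-- The energy estimate at a time at which the variational equations hold: they are tested with
the solution itself. -/
theorem SolvesAt.energy_estimate {T : ℝ} {σ : Plane → ℝ} {σs : ℝ}
    (hσ : AEMeasurable σ (volume.restrict Ω))
    (hσb : ∀ᵐ x ∂(volume.restrict Ω), 0 ≤ σ x ∧ σ x ≤ σs)
    {u : ℝ → Plane → Plane} {E₀ : ℝ → L2S Ω × L2V Ω} {B : ℝ → L2V Ω} {Ehat : ℝ → L2S Ω × L2V Ω}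
    {t : ℝ} (hu : AEStronglyMeasurable (u t) (volume.restrict Ω)) {M : ℝ}
    (hM : ∀ᵐ x ∂(volume.restrict Ω), ‖u t x‖ ≤ M)
    (h : SolvesAt Ω T σ u E₀ B Ehat t) :
    ∃ d : ℝ, HasDerivWithinAt (fun s => ‖B s‖ ^ 2) d (Icc 0 T) t ∧
      d + 1 / 2 * sigmaNormSq Ω σ (Ehat t).1 ≤
        curlSigmaNormSq Ω σ (E₀ t) + (2 * σs * supNorm Ω (u t) ^ 2 + 1) * ‖B t‖ ^ 2 := by
  obtain ⟨hB, hE, b, hb, hw, hv⟩ := h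
  refine ⟨2 * inner ℝ (B t) b, hb.norm_sq, ?_⟩
  have h1 := hw _ hB
  have h2 := hv _ hE
  rw [real_inner_comm] at h1
  rw [real_inner_comm] at h2
  have h3 := integral_weight_cross_sq_le hσ hσb hu hM (B t)
  have hrot : -(2 * inner ℝ (E₀ t).2 (B t)) ≤ ‖(E₀ t).2‖ ^ 2 + ‖B t‖ ^ 2 := by
    have := norm_add_sq_real (E₀ t).2 (B t)
    nlinarith [sq_nonneg ‖(E₀ t).2 + B t‖]
  rw [curlSigmaNormSq, sigmaNormSq_eq_integral hσb, sigmaNormSq_eq_integral hσb]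
  have ha := Lp.memLp (Ehat t).1
  have he := Lp.memLp (E₀ t).1
  have hc := memLp_cross hu hM (B t)
  have Iaa := integrable_weight_mul hσ hσb ha ha
  have Iea := integrable_weight_mul hσ hσb he ha
  have Iee := integrable_weight_mul hσ hσb he he
  have Ica := integrable_weight_mul hσ hσb hc ha
  have Icc' := integrable_weight_mul hσ hσb hc hc
  -- With `e = E₀`, `a = Ê`, `c = u × B`, the integrand is `σ((e + a)² + (2c + a)²/2)`. The `3/2` is
  -- what Young's inequality takes from `2‖σ^{1/2}Ê‖²`, leaving the `1/2` of the estimate.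
  have hyoung : 0 ≤ ∫ x in Ω, ((σ x * (E₀ t).1 x * (E₀ t).1 x
      + 2 * (σ x * (E₀ t).1 x * (Ehat t).1 x))
      + (3 / 2 * (σ x * (Ehat t).1 x * (Ehat t).1 x)
      + (2 * (σ x * cross (u t x) (B t x) * cross (u t x) (B t x))
      + 2 * (σ x * cross (u t x) (B t x) * (Ehat t).1 x)))) := by
    refine integral_nonneg_of_ae ?_
    filter_upwards [hσb] with x hx
    have := mul_nonneg hx.1 (sq_nonneg ((E₀ t).1 x + (Ehat t).1 x))
    have := mul_nonneg hx.1 (sq_nonneg (2 * cross (u t x) (B t x) + (Ehat t).1 x))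
    simp only [Pi.zero_apply]
    nlinarith
  rw [integral_add (Iee.fun_add (Iea.const_mul 2))
      ((Iaa.const_mul _).fun_add ((Icc'.const_mul 2).fun_add (Ica.const_mul 2))),
    integral_add Iee (Iea.const_mul 2),
    integral_add (Iaa.const_mul _) ((Icc'.const_mul 2).fun_add (Ica.const_mul 2)),
    integral_add (Icc'.const_mul 2) (Ica.const_mul 2)] at hyoung
  simp only [integral_const_mul] at hyoung
  linarith

end ResistiveMHD

end

/-! ### The two estimates for a solution. -/

theorem mainTheorem3
    (Ω : Set ResistiveMHD.Plane) (hΩ : IsOpen Ω) (T : ℝ) (hT : 0 < T)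
    -- the conductivity, with an upper bound `σs`
    (σ : ResistiveMHD.Plane → ℝ) (σs : ℝ)
    (hσ : AEMeasurable σ (volume.restrict Ω))
    (hσb : ∀ᵐ x ∂(volume.restrict Ω), 0 ≤ σ x ∧ σ x ≤ σs)
    -- the bounded velocity field
    (u : ℝ → ResistiveMHD.Plane → ResistiveMHD.Plane)
    (hu : Measurable (Function.uncurry u))
    (hub : ∃ M : ℝ, ∀ t ∈ Icc 0 T, ∀ᵐ x ∂(volume.restrict Ω), ‖u t x‖ ≤ M)
    -- the boundary datum `E₀ ∈ L²(0, T; H(rot; Ω))` and the initial datum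
    (E₀ : ℝ → ResistiveMHD.L2S Ω × ResistiveMHD.L2V Ω)
    (hE₀ : ∀ t ∈ Icc 0 T, E₀ t ∈ ResistiveMHD.HRot Ω)
    (hE₀' : MemLp E₀ 2 (volume.restrict (Icc 0 T)))
    (B₀ : ResistiveMHD.L2V Ω)
    -- a solution
    (B : ℝ → ResistiveMHD.L2V Ω) (Ehat : ℝ → ResistiveMHD.L2S Ω × ResistiveMHD.L2V Ω)
    (hsol : ResistiveMHD.IsSolution Ω T σ u E₀ B₀ B Ehat) :
    -- the differential estimate, at every time at which the equations hold
    (∀ t ∈ Icc 0 T, ResistiveMHD.SolvesAt Ω T σ u E₀ B Ehat t →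
      ∃ d : ℝ, HasDerivWithinAt (fun s => ‖B s‖ ^ 2) d (Icc 0 T) t ∧
        d + 1 / 2 * ResistiveMHD.sigmaNormSq Ω σ (Ehat t).1 ≤
          ResistiveMHD.curlSigmaNormSq Ω σ (E₀ t)
            + (2 * σs * ResistiveMHD.supNorm Ω (u t) ^ 2 + 1) * ‖B t‖ ^ 2) ∧
    -- the integrated estimate
    (IntervalIntegrable (fun τ => 2 * σs * ResistiveMHD.supNorm Ω (u τ) ^ 2 + 1) volume 0 T ∧
      ∃ β : ℝ → ℝ,
        (∀ t ∈ Icc 0 T, β t =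
          Real.exp (-∫ τ in (0 : ℝ)..t, (2 * σs * ResistiveMHD.supNorm Ω (u τ) ^ 2 + 1))) ∧
        (∀ t ∈ Icc 0 T, 0 < β t ∧ β t ≤ 1) ∧
        IntervalIntegrable
          (fun τ => β τ * ResistiveMHD.sigmaNormSq Ω σ (Ehat τ).1) volume 0 T ∧
        IntervalIntegrable
          (fun τ => β τ * ResistiveMHD.curlSigmaNormSq Ω σ (E₀ τ)) volume 0 T ∧
        ∀ t ∈ Icc 0 T,
          β t * ‖B t‖ ^ 2
              + 1 / 2 * ∫ τ in (0 : ℝ)..t, β τ * ResistiveMHD.sigmaNormSq Ω σ (Ehat τ).1 ≤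
            (∫ τ in (0 : ℝ)..t, β τ * ResistiveMHD.curlSigmaNormSq Ω σ (E₀ τ))
              + ‖B₀‖ ^ 2) := by
  obtain ⟨M, hM⟩ := hub
  have hut (t : ℝ) : AEStronglyMeasurable (u t) (volume.restrict Ω) :=
    (hu.comp measurable_prodMk_left).aestronglyMeasurable
  have henergy := fun t (ht : t ∈ Icc 0 T) (h : ResistiveMHD.SolvesAt Ω T σ u E₀ B Ehat t) =>
    h.energy_estimate hσ hσb (hut t) (hM t ht)
  have hg0 (t : ℝ) : 0 ≤ 2 * σs * ResistiveMHD.supNorm Ω (u t) ^ 2 + 1 := by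
    have := ResistiveMHD.mul_supNorm_sq_nonneg hσb (u t)
    linarith
  have hg : IntervalIntegrable (fun τ => 2 * σs * ResistiveMHD.supNorm Ω (u τ) ^ 2 + 1)
      volume 0 T := by
    have hsup : Measurable fun τ => ResistiveMHD.supNorm Ω (u τ) :=
      (ResistiveMHD.measurable_eLpNorm_top hu).ennreal_toReal
    have hsq : IntervalIntegrable (fun τ => ResistiveMHD.supNorm Ω (u τ) ^ 2) volume 0 T := by
      refine (intervalIntegrable_const (c := max M 0 ^ 2)).mono_fun'
        (hsup.pow_const 2).aestronglyMeasurable ?_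
      rw [uIoc_of_le hT.le, Filter.EventuallyLE, ae_restrict_iff' measurableSet_Ioc]
      filter_upwards with τ hτ
      rw [Real.norm_of_nonneg (sq_nonneg _)]
      exact pow_le_pow_left₀ (ResistiveMHD.supNorm_nonneg _)
        (ResistiveMHD.supNorm_le (hM τ (Ioc_subset_Icc_self hτ))) 2
    exact (hsq.const_mul _).add intervalIntegrable_const
  obtain ⟨m, hm⟩ := ResistiveMHD.exists_sigmaNormSq_eq hσ hσb
  have hF : IntervalIntegrable (fun τ => ResistiveMHD.curlSigmaNormSq Ω σ (E₀ τ)) volume 0 T := by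
    rw [intervalIntegrable_iff_integrableOn_Icc_of_le hT.le]
    simp only [ResistiveMHD.curlSigmaNormSq, hm]
    exact ((m.comp_memLp' hE₀'.fst).integrable_norm_pow two_ne_zero).add
      (hE₀'.snd.integrable_norm_pow two_ne_zero)
  have hS : AEStronglyMeasurable (fun τ => ResistiveMHD.sigmaNormSq Ω σ (Ehat τ).1)
      (volume.restrict (Icc 0 T)) := by
    simp only [hm]
    have hc : Continuous fun p : ResistiveMHD.L2S Ω × ResistiveMHD.L2V Ω => ‖m p.1‖ ^ 2 := by
      fun_prop
    exact hc.comp_aestronglyMeasurable hsol.measurable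
  have hy : AbsolutelyContinuousOnInterval (fun t => ‖B t‖ ^ 2) 0 T := by
    simp only [sq]
    exact hsol.absCont.norm.mul hsol.absCont.norm
  have hmain := integratingFactor_estimate hT hy hg (fun t _ => hg0 t) hF hS
    (fun t => ResistiveMHD.sigmaNormSq_nonneg σ _) (by
      filter_upwards [hsol.equations, ae_restrict_mem measurableSet_Icc] with t ht hmem
      exact henergy t hmem ht) (fun _ => rfl)
  rw [hsol.initial] at hmain
  exact ⟨henergy, hg, _, fun _ _ => rfl, hmain⟩
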